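/- Let $\Phi:\mathbb{R}^2\to\mathbb{R}$ be a smooth convex function satisfying the Kähler–Einstein equation $e^{-\Phi}=\det D^2\Phi$ on $\mathbb{R}^2$ (so that $D^2\Phi$ is positive definite). Equip $\mathbb{R}^2$ with the Riemannian metric $h=\Phi_{ij}\,dx^i dx^j$, where $\Phi_{ij}=\partial_{ij}\Phi$. Let $R$ be the sectional curvature of $h$, put $\lambda=4R$, and let $Lf=\Phi^{ij}\partial_{ij}f$, where $(\Phi^{ij})=(D^2\Phi)^{-1}$. Let $\nabla$, $\langle\cdot,\cdot\rangle$ and $|\cdot|$ be the gradient, the inner product and the norm of the metric $h$, so that $\langle\nabla f,\nabla g\rangle=\Phi^{ij}\,\partial_i f\,\partial_j g$. Then at every point where $8\lambda+|\nabla\Phi|^2\neq 0$, $$ 2L\lambda=(3\lambda-1)(\lambda+1)+\frac{|\nabla\Phi|^2}{8\lambda+|\nabla\Phi|^2}(3\lambda-1)^2+\frac{16|\nabla\lambda|^2+2\bigl[4(1-\lambda)+|\nabla\Phi|^2\bigr]\langle\nabla\Phi,\nabla\lambda\rangle}{8\lambda+|\nabla\Phi|^2}. $$ Moreover, at every point of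 $\mathbb{R}^2$ the identity holds after multiplication by $8\lambda+|\nabla\Phi|^2$, that is, $$ 2(8\lambda+|\nabla\Phi|^2)L\lambda=(8\lambda+|\nabla\Phi|^2)(3\lambda-1)(\lambda+1)+|\nabla\Phi|^2(3\lambda-1)^2+16|\nabla\lambda|^2+2\bigl[4(1-\lambda)+|\nabla\Phi|^2\bigr]\langle\nabla\Phi,\nabla\lambda\rangle. $$ -/

import Mathlib

open scoped ContDiff

noncomputable section

namespace HessianGeometry

/-- The `i`-th partial derivative `∂ᵢ f`. -/
def pd {n : ℕ} (i : Fin n) (f : EuclideanSpace ℝ (Fin n) → ℝ) :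
    EuclideanSpace ℝ (Fin n) → ℝ :=
  fun x => fderiv ℝ f x (EuclideanSpace.single i 1)

/-- The Euclidean Hessian `D²Φ`, with entries `Φᵢⱼ = ∂ᵢ ∂ⱼ Φ`; for strongly convex `Φ` it is
regarded as a Riemannian metric on `ℝⁿ`. -/
def hess {n : ℕ} (Φ : EuclideanSpace ℝ (Fin n) → ℝ) (x : EuclideanSpace ℝ (Fin n)) :
    Matrix (Fin n) (Fin n) ℝ :=
  Matrix.of fun i j => pd i (pd j Φ) x

/-- The inner product `⟨u, v⟩ = hᵢⱼ uⁱ vʲ` of two tangent vectors at `x`. -/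
def metricInner {n : ℕ} (h : EuclideanSpace ℝ (Fin n) → Matrix (Fin n) (Fin n) ℝ)
    (x : EuclideanSpace ℝ (Fin n)) (u v : Fin n → ℝ) : ℝ :=
  ∑ i, ∑ j, h x i j * u i * v j

/-- The Riemannian gradient `(∇f)ⁱ = hⁱʲ ∂ⱼ f`. -/
def riemGrad {n : ℕ} (h : EuclideanSpace ℝ (Fin n) → Matrix (Fin n) (Fin n) ℝ)
    (f : EuclideanSpace ℝ (Fin n) → ℝ) (x : EuclideanSpace ℝ (Fin n)) : Fin n → ℝ :=
  fun i => ∑ j, (h x)⁻¹ i j * pd j f x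

/-- The Christoffel symbols `Γᵏᵢⱼ = ½ hᵏˡ (∂ᵢ hⱼₗ + ∂ⱼ hᵢₗ - ∂ₗ hᵢⱼ)` of the Levi-Civita
connection of the metric `h`. -/
def christoffel {n : ℕ} (h : EuclideanSpace ℝ (Fin n) → Matrix (Fin n) (Fin n) ℝ)
    (k i j : Fin n) (x : EuclideanSpace ℝ (Fin n)) : ℝ :=
  (1 / 2) * ∑ l, (h x)⁻¹ k l *
    (pd i (fun y => h y j l) x + pd j (fun y => h y i l) x - pd l (fun y => h y i j) x)

/-- The `l`-th component of `R(∂ᵢ, ∂ⱼ)∂ₖ`, where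
`R(X, Y)Z = ∇_X ∇_Y Z - ∇_Y ∇_X Z - ∇_[X,Y] Z`. -/
def riemannCurv {n : ℕ} (h : EuclideanSpace ℝ (Fin n) → Matrix (Fin n) (Fin n) ℝ)
    (l i j k : Fin n) (x : EuclideanSpace ℝ (Fin n)) : ℝ :=
  pd i (christoffel h l j k) x - pd j (christoffel h l i k) x +
    ∑ m, (christoffel h l i m x * christoffel h m j k x -
      christoffel h l j m x * christoffel h m i k x)

/-- The sectional curvature `⟨R(u, v)v, u⟩ / (⟨u, u⟩⟨v, v⟩ - ⟨u, v⟩²)` of the plane spanned by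
the linearly independent tangent vectors `u`, `v` at `x`. -/
def sectionalCurvature {n : ℕ} (h : EuclideanSpace ℝ (Fin n) → Matrix (Fin n) (Fin n) ℝ)
    (x : EuclideanSpace ℝ (Fin n)) (u v : Fin n → ℝ) : ℝ :=
  metricInner h x (fun l => ∑ i, ∑ j, ∑ k, riemannCurv h l i j k x * u i * v j * v k) u /
    (metricInner h x u u * metricInner h x v v - metricInner h x u v ^ 2)

/-- `λ = 4R`, where `R` is the sectional curvature of the Hessian metric `D²Φ` on `ℝ²`; the only
tangent plane at a point is spanned by the two coordinate vectors. -/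
def lam (Φ : EuclideanSpace ℝ (Fin 2) → ℝ) (x : EuclideanSpace ℝ (Fin 2)) : ℝ :=
  4 * sectionalCurvature (hess Φ) x (Pi.single 0 1) (Pi.single 1 1)

/-- The weighted Laplacian `L f = Φⁱʲ ∂ᵢ ∂ⱼ f`. -/
def weightedLaplacian {n : ℕ} (Φ f : EuclideanSpace ℝ (Fin n) → ℝ)
    (x : EuclideanSpace ℝ (Fin n)) : ℝ :=
  ∑ i, ∑ j, (hess Φ x)⁻¹ i j * pd i (pd j f) x

/-- `⟨∇f, ∇g⟩`, with gradients and inner product taken in the Hessian metric `D²Φ`. -/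
def gradInner {n : ℕ} (Φ f g : EuclideanSpace ℝ (Fin n) → ℝ)
    (x : EuclideanSpace ℝ (Fin n)) : ℝ :=
  metricInner (hess Φ) x (riemGrad (hess Φ) f x) (riemGrad (hess Φ) g x)

end HessianGeometry

end

open scoped ContDiff

namespace HessianGeometry


/-- Minus the determinant of the matrix with the given three rows. -/
def tri (a b c p q r t u v : ℝ) : ℝ :=
  a * (r * u - q * v) + b * (p * v - r * t) + c * (q * t - p * u)

/-- The pointwise identity between the derivatives of `Φ` (first `f g`, second `a 0 d`, third
`p q r s`, fourth `u0 … u4`, fifth `w0 … w5`) at a point where the Hessian is diagonal. -/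
theorem jet_identity_diag
    {a d f g p q r s u0 u1 u2 u3 u4 w0 w1 w2 w3 w4 w5 E l l1 l2 l11 l22 : ℝ}
    (ha : a ≠ 0) (hd : d ≠ 0) (hE : E * (a * d) = 1)
    (h1 : d * p + a * r = -(f * (a * d)))
    (h2 : d * q + a * s = -(g * (a * d)))
    (h11 : d * u0 + a * u2 + 2 * (p * r - q ^ 2) = (f ^ 2 - a) * (a * d))
    (h12 : d * u1 + a * u3 + (p * s - q * r) = f * g * (a * d))
    (h22 : d * u2 + a * u4 + 2 * (q * s - r ^ 2) = (g ^ 2 - d) * (a * d))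
    (h111 : d * w0 + a * w2 + 3 * (u0 * r + p * u2 - 2 * q * u1) =
      (3 * f * a - f ^ 3 - p) * (a * d))
    (h112 : d * w1 + a * w3 + (u0 * s + 2 * p * u3 - 3 * q * u2) =
      (g * a - f ^ 2 * g - q) * (a * d))
    (h122 : d * w2 + a * w4 + (2 * u1 * s + p * u4 - 3 * r * u2) =
      (f * d - f * g ^ 2 - r) * (a * d))
    (h222 : d * w3 + a * w5 + 3 * (u2 * s + q * u4 - 2 * r * u3) =
      (3 * g * d - g ^ 3 - s) * (a * d))
    (hl : l = E ^ 2 * tri a 0 d p q r q r s)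
    (hl1 : l1 = E ^ 2 * (tri a 0 d u0 u1 u2 q r s + tri a 0 d p q r u1 u2 u3
      + 2 * f * tri a 0 d p q r q r s))
    (hl2 : l2 = E ^ 2 * (tri a 0 d u1 u2 u3 q r s + tri a 0 d p q r u2 u3 u4
      + 2 * g * tri a 0 d p q r q r s))
    (hl11 : l11 = E ^ 2 * (tri p q r u0 u1 u2 q r s + tri a 0 d w0 w1 w2 q r s
      + 2 * tri a 0 d u0 u1 u2 u1 u2 u3 + tri a 0 d p q r w1 w2 w3
      + 4 * f * (tri a 0 d u0 u1 u2 q r s + tri a 0 d p q r u1 u2 u3)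
      + (2 * a + 4 * f ^ 2) * tri a 0 d p q r q r s))
    (hl22 : l22 = E ^ 2 * (tri q r s p q r u2 u3 u4 + tri a 0 d w2 w3 w4 q r s
      + 2 * tri a 0 d u1 u2 u3 u2 u3 u4 + tri a 0 d p q r w3 w4 w5
      + 4 * g * (tri a 0 d u1 u2 u3 q r s + tri a 0 d p q r u2 u3 u4)
      + (2 * d + 4 * g ^ 2) * tri a 0 d p q r q r s)) :
    2 * (8 * l + E * (d * f ^ 2 + a * g ^ 2)) * (E * (d * l11 + a * l22)) =
      (8 * l + E * (d * f ^ 2 + a * g ^ 2)) * ((3 * l - 1) * (l + 1)) +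
      E * (d * f ^ 2 + a * g ^ 2) * (3 * l - 1) ^ 2 +
      16 * (E * (d * l1 ^ 2 + a * l2 ^ 2)) +
      2 * (4 * (1 - l) + E * (d * f ^ 2 + a * g ^ 2)) * (E * (d * f * l1 + a * g * l2)) := by
  obtain rfl : E = 1 / (a * d) := by field_simp; linear_combination hE
  have hL : d * l11 + a * l22 = (1 / (a * d)) ^ 2 * (
      d * (tri p q r u0 u1 u2 q r s + 2 * tri a 0 d u0 u1 u2 u1 u2 u3
        + 4 * f * (tri a 0 d u0 u1 u2 q r s + tri a 0 d p q r u1 u2 u3)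
        + (2 * a + 4 * f ^ 2) * tri a 0 d p q r q r s)
      + a * (tri q r s p q r u2 u3 u4 + 2 * tri a 0 d u1 u2 u3 u2 u3 u4
        + 4 * g * (tri a 0 d u1 u2 u3 q r s + tri a 0 d p q r u2 u3 u4)
        + (2 * d + 4 * g ^ 2) * tri a 0 d p q r q r s)
      + tri a 0 d (d * w0 + a * w2) (d * w1 + a * w3) (d * w2 + a * w4) q r s
      + tri a 0 d p q r (d * w1 + a * w3) (d * w2 + a * w4) (d * w3 + a * w5)) := by
    rw [hl11, hl22]
    simp only [tri]
    ring
  rw [eq_sub_of_add_eq h111, eq_sub_of_add_eq h112, eq_sub_of_add_eq h122,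
    eq_sub_of_add_eq h222] at hL
  rw [hL, hl1, hl2, hl]
  clear hL hl1 hl2 hl hl11 hl22 h111 h112 h122 h222 hE
  obtain ⟨P, rfl⟩ : ∃ P, p = a * P := ⟨p / a, by field_simp⟩
  obtain ⟨Q, rfl⟩ : ∃ P, q = a * P := ⟨q / a, by field_simp⟩
  obtain ⟨U, rfl⟩ : ∃ U, u0 = a * U := ⟨u0 / a, by field_simp⟩
  obtain ⟨V, rfl⟩ : ∃ V, u1 = a * V := ⟨u1 / a, by field_simp⟩
  obtain rfl : r = - (d * (f + P)) := by
    apply mul_left_cancel₀ ha; linear_combination h1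
  obtain rfl : s = - (d * (g + Q)) := by
    apply mul_left_cancel₀ ha; linear_combination h2
  obtain rfl : u2 = d * (f ^ 2 - a) - d * U + 2 * d * P * (P + f) + 2 * a * Q ^ 2 := by
    apply mul_left_cancel₀ ha; linear_combination h11
  obtain rfl : u3 = d * (f * g - V + P * g - Q * f) := by
    apply mul_left_cancel₀ ha; linear_combination h12
  obtain rfl : u4 = d * (g ^ 2 - d) + 2 * d * Q * (Q + g)
      - d * (d * (f ^ 2 - a) - d * U + 2 * d * P * (P + f) + 2 * a * Q ^ 2) / a
      + 2 * d ^ 2 * (P + f) ^ 2 / a := by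
    field_simp; linear_combination h22
  clear h1 h2 h11 h12 h22
  simp only [tri]
  field_simp
  ring

/-- The pointwise identity between the derivatives of `Φ`, reduced to the diagonal case by the shear
`∂₁ ↦ ∂₁ - k ∂₀` that diagonalises the Hessian `a b c`. -/
theorem jet_identity
    {a b c f g p q r s u0 u1 u2 u3 u4 w0 w1 w2 w3 w4 w5 e E l l1 l2 l11 l12 l22 : ℝ}
    (he : a * c - b ^ 2 = e) (hE : E * e = 1)
    (h1 : c * p - 2 * b * q + a * r = -(f * e))
    (h2 : c * q - 2 * b * r + a * s = -(g * e))
    (h11 : c * u0 - 2 * b * u1 + a * u2 + 2 * (p * r - q ^ 2) = (f ^ 2 - a) * e)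
    (h12 : c * u1 - 2 * b * u2 + a * u3 + (p * s - q * r) = (f * g - b) * e)
    (h22 : c * u2 - 2 * b * u3 + a * u4 + 2 * (q * s - r ^ 2) = (g ^ 2 - c) * e)
    (h111 : c * w0 - 2 * b * w1 + a * w2 + 3 * (u0 * r + p * u2 - 2 * q * u1) =
      (3 * f * a - f ^ 3 - p) * e)
    (h112 : c * w1 - 2 * b * w2 + a * w3 + (u0 * s + 2 * p * u3 - 3 * q * u2) =
      (2 * f * b + g * a - f ^ 2 * g - q) * e)
    (h122 : c * w2 - 2 * b * w3 + a * w4 + (2 * u1 * s + p * u4 - 3 * r * u2) =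
      (2 * g * b + f * c - f * g ^ 2 - r) * e)
    (h222 : c * w3 - 2 * b * w4 + a * w5 + 3 * (u2 * s + q * u4 - 2 * r * u3) =
      (3 * g * c - g ^ 3 - s) * e)
    (hl : l = E ^ 2 * tri a b c p q r q r s)
    (hl1 : l1 = E ^ 2 * (tri a b c u0 u1 u2 q r s + tri a b c p q r u1 u2 u3
      + 2 * f * tri a b c p q r q r s))
    (hl2 : l2 = E ^ 2 * (tri a b c u1 u2 u3 q r s + tri a b c p q r u2 u3 u4
      + 2 * g * tri a b c p q r q r s))
    (hl11 : l11 = E ^ 2 * (tri p q r u0 u1 u2 q r s + tri a b c w0 w1 w2 q r s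
      + 2 * tri a b c u0 u1 u2 u1 u2 u3 + tri a b c p q r w1 w2 w3
      + 4 * f * (tri a b c u0 u1 u2 q r s + tri a b c p q r u1 u2 u3)
      + (2 * a + 4 * f ^ 2) * tri a b c p q r q r s))
    (hl12 : l12 = E ^ 2 * (tri a b c w1 w2 w3 q r s + tri a b c u0 u1 u2 u2 u3 u4
      + tri q r s p q r u1 u2 u3 + tri a b c p q r w2 w3 w4
      + 2 * f * (tri a b c u1 u2 u3 q r s + tri a b c p q r u2 u3 u4)
      + 2 * g * (tri a b c u0 u1 u2 q r s + tri a b c p q r u1 u2 u3)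
      + (2 * b + 4 * f * g) * tri a b c p q r q r s))
    (hl22 : l22 = E ^ 2 * (tri q r s p q r u2 u3 u4 + tri a b c w2 w3 w4 q r s
      + 2 * tri a b c u1 u2 u3 u2 u3 u4 + tri a b c p q r w3 w4 w5
      + 4 * g * (tri a b c u1 u2 u3 q r s + tri a b c p q r u2 u3 u4)
      + (2 * c + 4 * g ^ 2) * tri a b c p q r q r s)) (ha : a ≠ 0) :
    2 * (8 * l + E * (c * f ^ 2 - 2 * b * f * g + a * g ^ 2)) *
        (E * (c * l11 - 2 * b * l12 + a * l22)) =
      (8 * l + E * (c * f ^ 2 - 2 * b * f * g + a * g ^ 2)) * ((3 * l - 1) * (l + 1)) +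
      E * (c * f ^ 2 - 2 * b * f * g + a * g ^ 2) * (3 * l - 1) ^ 2 +
      16 * (E * (c * l1 ^ 2 - 2 * b * l1 * l2 + a * l2 ^ 2)) +
      2 * (4 * (1 - l) + E * (c * f ^ 2 - 2 * b * f * g + a * g ^ 2)) *
        (E * (c * f * l1 - b * (f * l2 + g * l1) + a * g * l2)) := by
  obtain ⟨k, rfl⟩ : ∃ k, b = k * a := ⟨b / a, by field_simp⟩
  obtain ⟨d, rfl⟩ : ∃ d, c = d + k ^ 2 * a := ⟨c - k ^ 2 * a, by ring⟩
  obtain rfl : e = a * d := by linear_combination -he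
  have hd : d ≠ 0 := by rintro rfl; simp at hE
  obtain ⟨g, rfl⟩ : ∃ y, g = y + k * f := ⟨g - k * f, by ring⟩
  obtain ⟨q, rfl⟩ : ∃ y, q = y + k * p := ⟨q - k * p, by ring⟩
  obtain ⟨r, rfl⟩ : ∃ y, r = y + 2 * k * q + k ^ 2 * p :=
    ⟨r - (2 * k * q + k ^ 2 * p), by ring⟩
  obtain ⟨s, rfl⟩ : ∃ y, s = y + 3 * k * r + 3 * k ^ 2 * q + k ^ 3 * p :=
    ⟨s - (3 * k * r + 3 * k ^ 2 * q + k ^ 3 * p), by ring⟩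
  obtain ⟨u1, rfl⟩ : ∃ y, u1 = y + k * u0 := ⟨u1 - k * u0, by ring⟩
  obtain ⟨u2, rfl⟩ : ∃ y, u2 = y + 2 * k * u1 + k ^ 2 * u0 :=
    ⟨u2 - (2 * k * u1 + k ^ 2 * u0), by ring⟩
  obtain ⟨u3, rfl⟩ : ∃ y, u3 = y + 3 * k * u2 + 3 * k ^ 2 * u1 + k ^ 3 * u0 :=
    ⟨u3 - (3 * k * u2 + 3 * k ^ 2 * u1 + k ^ 3 * u0), by ring⟩
  obtain ⟨u4, rfl⟩ : ∃ y, u4 = y + 4 * k * u3 + 6 * k ^ 2 * u2 + 4 * k ^ 3 * u1 + k ^ 4 * u0 :=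
    ⟨u4 - (4 * k * u3 + 6 * k ^ 2 * u2 + 4 * k ^ 3 * u1 + k ^ 4 * u0), by ring⟩
  obtain ⟨w1, rfl⟩ : ∃ y, w1 = y + k * w0 := ⟨w1 - k * w0, by ring⟩
  obtain ⟨w2, rfl⟩ : ∃ y, w2 = y + 2 * k * w1 + k ^ 2 * w0 :=
    ⟨w2 - (2 * k * w1 + k ^ 2 * w0), by ring⟩
  obtain ⟨w3, rfl⟩ : ∃ y, w3 = y + 3 * k * w2 + 3 * k ^ 2 * w1 + k ^ 3 * w0 :=
    ⟨w3 - (3 * k * w2 + 3 * k ^ 2 * w1 + k ^ 3 * w0), by ring⟩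
  obtain ⟨w4, rfl⟩ : ∃ y, w4 = y + 4 * k * w3 + 6 * k ^ 2 * w2 + 4 * k ^ 3 * w1 + k ^ 4 * w0 :=
    ⟨w4 - (4 * k * w3 + 6 * k ^ 2 * w2 + 4 * k ^ 3 * w1 + k ^ 4 * w0), by ring⟩
  obtain ⟨w5, rfl⟩ : ∃ y, w5 = y + 5 * k * w4 + 10 * k ^ 2 * w3 + 10 * k ^ 3 * w2
      + 5 * k ^ 4 * w1 + k ^ 5 * w0 :=
    ⟨w5 - (5 * k * w4 + 10 * k ^ 2 * w3 + 10 * k ^ 3 * w2 + 5 * k ^ 4 * w1 + k ^ 5 * w0), by ring⟩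
  simp only [tri] at hl hl1 hl2 hl11 hl12 hl22
  have key := jet_identity_diag (a := a) (d := d) (f := f) (g := g) (p := p) (q := q) (r := r)
    (s := s) (u0 := u0) (u1 := u1) (u2 := u2) (u3 := u3) (u4 := u4) (w0 := w0) (w1 := w1)
    (w2 := w2) (w3 := w3) (w4 := w4) (w5 := w5) (E := E) (l := l) (l1 := l1) (l2 := l2 - k * l1)
    (l11 := l11) (l22 := l22 - 2 * k * l12 + k ^ 2 * l11) ha hd hE
    (by linear_combination h1)
    (by linear_combination h2 - k * h1)
    (by linear_combination h11)
    (by linear_combination h12 - k * h11)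
    (by linear_combination h22 - 2 * k * h12 + k ^ 2 * h11)
    (by linear_combination h111)
    (by linear_combination h112 - k * h111)
    (by linear_combination h122 - 2 * k * h112 + k ^ 2 * h111)
    (by linear_combination h222 - 3 * k * h122 + 3 * k ^ 2 * h112 - k ^ 3 * h111)
    (by simp only [tri]; linear_combination hl)
    (by simp only [tri]; linear_combination hl1)
    (by simp only [tri]; linear_combination hl2 - k * hl1)
    (by simp only [tri]; linear_combination hl11)
    (by simp only [tri]; linear_combination hl22 - 2 * k * hl12 + k ^ 2 * hl11)
  linear_combination key


section PartialDerivatives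

variable {n : ℕ} {i j : Fin n} {f g : EuclideanSpace ℝ (Fin n) → ℝ} {x : EuclideanSpace ℝ (Fin n)}

theorem contDiff_pd (hf : ContDiff ℝ ∞ f) : ContDiff ℝ ∞ (pd i f) :=
  (hf.fderiv_right (m := ∞) le_rfl).clm_apply contDiff_const

theorem pd_comm (hf : ContDiff ℝ ∞ f) : pd i (pd j f) = pd j (pd i f) := by
  funext x
  have hd : DifferentiableAt ℝ (fderiv ℝ f) x :=
    (hf.fderiv_right (m := ∞) le_rfl).differentiable (by simp) x
  have hs : IsSymmSndFDerivAt ℝ f x := hf.contDiffAt.isSymmSndFDerivAt (by simp; exact WithTop.coe_le_coe.2 le_top)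
  unfold pd
  rw [fderiv_clm_apply hd (by fun_prop), fderiv_clm_apply hd (by fun_prop)]
  simpa using hs.eq _ _

theorem pd_const (c : ℝ) : pd i (fun _ => c) x = 0 := by simp [pd]

theorem pd_neg : pd i (fun y => -f y) x = -pd i f x := by
  simp [pd]

theorem pd_add (hf : Differentiable ℝ f) (hg : Differentiable ℝ g) :
    pd i (fun y => f y + g y) x = pd i f x + pd i g x := by
  simp [pd, fderiv_fun_add (hf x) (hg x)]

theorem pd_sub (hf : Differentiable ℝ f) (hg : Differentiable ℝ g) :
    pd i (fun y => f y - g y) x = pd i f x - pd i g x := by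
  simp [pd, fderiv_fun_sub (hf x) (hg x)]

theorem pd_mul (hf : Differentiable ℝ f) (hg : Differentiable ℝ g) :
    pd i (fun y => f y * g y) x = pd i f x * g x + f x * pd i g x := by
  simp [pd, fderiv_fun_mul (hf x) (hg x)]
  ring

theorem pd_pow (hf : Differentiable ℝ f) (k : ℕ) :
    pd i (fun y => f y ^ k) x = k * f x ^ (k - 1) * pd i f x := by
  simp [pd, fderiv_fun_pow k (hf x)]

theorem pd_exp (hf : Differentiable ℝ f) :
    pd i (fun y => Real.exp (f y)) x = Real.exp (f x) * pd i f x := by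
  simp [pd, fderiv_exp (hf x)]

end PartialDerivatives

section Plane

variable {Φ : EuclideanSpace ℝ (Fin 2) → ℝ}

/-- The mixed partial derivative `∂₀ᵐ ∂₁ⁿ Φ`. -/
noncomputable def jet (Φ : EuclideanSpace ℝ (Fin 2) → ℝ) (m n : ℕ) : EuclideanSpace ℝ (Fin 2) → ℝ :=
  (pd 0)^[m] ((pd 1)^[n] Φ)

theorem contDiff_jet (hΦ : ContDiff ℝ ∞ Φ) (m n : ℕ) : ContDiff ℝ ∞ (jet Φ m n) := by
  have h : ∀ (i : Fin 2) (k : ℕ) (f : EuclideanSpace ℝ (Fin 2) → ℝ), ContDiff ℝ ∞ f →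
      ContDiff ℝ ∞ ((pd i)^[k] f) := by
    intro i k
    induction k with
    | zero => exact fun f hf => hf
    | succ k ih => exact fun f hf => ih _ (contDiff_pd hf)
  exact h _ _ _ (h _ _ _ hΦ)

theorem pd_zero_jet (m n : ℕ) : pd 0 (jet Φ m n) = jet Φ (m + 1) n := by
  simp only [jet, Function.iterate_succ_apply']

theorem pd_one_jet (hΦ : ContDiff ℝ ∞ Φ) (m n : ℕ) : pd 1 (jet Φ m n) = jet Φ m (n + 1) := by
  induction m with
  | zero => simp only [jet, Function.iterate_succ_apply', Function.iterate_zero, id]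
  | succ m ih => rw [← pd_zero_jet, pd_comm (contDiff_jet hΦ m n), ih, pd_zero_jet]

theorem pd_zero_eq_jet (Φ : EuclideanSpace ℝ (Fin 2) → ℝ) : pd 0 Φ = jet Φ 1 0 := rfl

theorem pd_one_eq_jet (Φ : EuclideanSpace ℝ (Fin 2) → ℝ) : pd 1 Φ = jet Φ 0 1 := rfl

theorem det_hess (hΦ : ContDiff ℝ ∞ Φ) (x : EuclideanSpace ℝ (Fin 2)) :
    (hess Φ x).det = jet Φ 2 0 x * jet Φ 0 2 x - jet Φ 1 1 x ^ 2 := by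
  simp [hess, Matrix.det_fin_two, pd_zero_eq_jet Φ, pd_one_eq_jet Φ, pd_zero_jet, pd_one_jet hΦ]
  ring

theorem inv_hess (hΦ : ContDiff ℝ ∞ Φ) (hKE : ∀ x, Real.exp (-Φ x) = (hess Φ x).det)
    (x : EuclideanSpace ℝ (Fin 2)) :
    (hess Φ x)⁻¹ = Real.exp (Φ x) •
      !![jet Φ 0 2 x, -jet Φ 1 1 x; -jet Φ 1 1 x, jet Φ 2 0 x] := by
  rw [Matrix.inv_def, ← hKE, Ring.inverse_eq_inv', ← Real.exp_neg, neg_neg,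
    Matrix.adjugate_fin_two]
  simp [hess, pd_zero_eq_jet Φ, pd_one_eq_jet Φ, pd_zero_jet, pd_one_jet hΦ]

theorem gradInner_eq (hΦ : ContDiff ℝ ∞ Φ) (hKE : ∀ x, Real.exp (-Φ x) = (hess Φ x).det)
    (f g : EuclideanSpace ℝ (Fin 2) → ℝ) (x : EuclideanSpace ℝ (Fin 2)) :
    gradInner Φ f g x = Real.exp (Φ x) * (jet Φ 0 2 x * pd 0 f x * pd 0 g x
      - jet Φ 1 1 x * (pd 0 f x * pd 1 g x + pd 1 f x * pd 0 g x)
      + jet Φ 2 0 x * pd 1 f x * pd 1 g x) := by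
  have hE : Real.exp (Φ x) * (jet Φ 2 0 x * jet Φ 0 2 x - jet Φ 1 1 x ^ 2) = 1 := by
    rw [← det_hess hΦ, ← hKE, ← Real.exp_add]; simp
  simp only [gradInner, metricInner, riemGrad, inv_hess hΦ hKE]
  simp [hess, pd_zero_eq_jet Φ, pd_one_eq_jet Φ, pd_zero_jet, pd_one_jet hΦ]
  linear_combination Real.exp (Φ x) * (jet Φ 0 2 x * pd 0 f x * pd 0 g x
      - jet Φ 1 1 x * (pd 0 f x * pd 1 g x + pd 1 f x * pd 0 g x)
      + jet Φ 2 0 x * pd 1 f x * pd 1 g x) * hE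

theorem weightedLaplacian_eq (hΦ : ContDiff ℝ ∞ Φ)
    (hKE : ∀ x, Real.exp (-Φ x) = (hess Φ x).det)
    {f : EuclideanSpace ℝ (Fin 2) → ℝ} (hf : ContDiff ℝ ∞ f) (x : EuclideanSpace ℝ (Fin 2)) :
    weightedLaplacian Φ f x = Real.exp (Φ x) * (jet Φ 0 2 x * pd 0 (pd 0 f) x
      - 2 * jet Φ 1 1 x * pd 1 (pd 0 f) x + jet Φ 2 0 x * pd 1 (pd 1 f) x) := by
  simp only [weightedLaplacian, inv_hess hΦ hKE]
  simp [pd_comm hf (i := 0) (j := 1)]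
  ring

theorem christoffel_hess_zero (hΦ : ContDiff ℝ ∞ Φ)
    (hKE : ∀ x, Real.exp (-Φ x) = (hess Φ x).det) (i j : Fin 2) :
    christoffel (hess Φ) 0 i j = fun x => 1 / 2 * (Real.exp (Φ x) *
      (jet Φ 0 2 x * pd i (pd j (jet Φ 1 0)) x - jet Φ 1 1 x * pd i (pd j (jet Φ 0 1)) x)) := by
  funext x
  simp only [christoffel, inv_hess hΦ hKE]
  fin_cases i <;> fin_cases j <;>
    simp [hess, pd_zero_eq_jet Φ, pd_one_eq_jet Φ, pd_zero_jet, pd_one_jet hΦ] <;> ring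

theorem christoffel_hess_one (hΦ : ContDiff ℝ ∞ Φ)
    (hKE : ∀ x, Real.exp (-Φ x) = (hess Φ x).det) (i j : Fin 2) :
    christoffel (hess Φ) 1 i j = fun x => 1 / 2 * (Real.exp (Φ x) *
      (jet Φ 2 0 x * pd i (pd j (jet Φ 0 1)) x - jet Φ 1 1 x * pd i (pd j (jet Φ 1 0)) x)) := by
  funext x
  simp only [christoffel, inv_hess hΦ hKE]
  fin_cases i <;> fin_cases j <;>
    simp [hess, pd_zero_eq_jet Φ, pd_one_eq_jet Φ, pd_zero_jet, pd_one_jet hΦ] <;> ring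

theorem jet_det (hΦ : ContDiff ℝ ∞ Φ) (hKE : ∀ x, Real.exp (-Φ x) = (hess Φ x).det)
    (x : EuclideanSpace ℝ (Fin 2)) :
    jet Φ 2 0 x * jet Φ 0 2 x - jet Φ 1 1 x ^ 2 = Real.exp (-Φ x) := by
  rw [hKE, det_hess hΦ]

theorem jet_det_pd_zero (hΦ : ContDiff ℝ ∞ Φ) (hKE : ∀ x, Real.exp (-Φ x) = (hess Φ x).det)
    (x : EuclideanSpace ℝ (Fin 2)) :
    jet Φ 0 2 x * jet Φ 3 0 x - 2 * jet Φ 1 1 x * jet Φ 2 1 x + jet Φ 2 0 x * jet Φ 1 2 x =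
      -(jet Φ 1 0 x * Real.exp (-Φ x)) := by
  have hd : Differentiable ℝ Φ := hΦ.differentiable (by simp)
  have hJ : ∀ m n, Differentiable ℝ (jet Φ m n) := fun m n =>
    (contDiff_jet hΦ m n).differentiable (by simp)
  have h := congrArg (fun F => pd 0 F x) (funext (jet_det hΦ hKE))
  simp (disch := fun_prop) only [pd_mul, pd_sub, pd_pow, pd_exp, pd_neg, pd_zero_eq_jet Φ,
    pd_zero_jet, Nat.reduceAdd] at h
  simp at h
  linear_combination h

theorem jet_det_pd_one (hΦ : ContDiff ℝ ∞ Φ) (hKE : ∀ x, Real.exp (-Φ x) = (hess Φ x).det)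
    (x : EuclideanSpace ℝ (Fin 2)) :
    jet Φ 0 2 x * jet Φ 2 1 x - 2 * jet Φ 1 1 x * jet Φ 1 2 x + jet Φ 2 0 x * jet Φ 0 3 x =
      -(jet Φ 0 1 x * Real.exp (-Φ x)) := by
  have hd : Differentiable ℝ Φ := hΦ.differentiable (by simp)
  have hJ : ∀ m n, Differentiable ℝ (jet Φ m n) := fun m n =>
    (contDiff_jet hΦ m n).differentiable (by simp)
  have h := congrArg (fun F => pd 1 F x) (funext (jet_det hΦ hKE))
  simp (disch := fun_prop) only [pd_mul, pd_sub, pd_pow, pd_exp, pd_neg, pd_one_eq_jet Φ,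
    pd_one_jet hΦ, Nat.reduceAdd] at h
  simp at h
  linear_combination h

/-- For a solution of the Kähler–Einstein equation, `λ` is polynomial in `exp Φ` and the second and
third derivatives of `Φ`. -/
theorem lam_eq (hΦ : ContDiff ℝ ∞ Φ) (hKE : ∀ x, Real.exp (-Φ x) = (hess Φ x).det) :
    lam Φ = fun x => Real.exp (Φ x) ^ 2 * tri (jet Φ 2 0 x) (jet Φ 1 1 x) (jet Φ 0 2 x)
      (jet Φ 3 0 x) (jet Φ 2 1 x) (jet Φ 1 2 x) (jet Φ 2 1 x) (jet Φ 1 2 x) (jet Φ 0 3 x) := by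
  funext x
  have hd : Differentiable ℝ Φ := hΦ.differentiable (by simp)
  have hJ : ∀ m n, Differentiable ℝ (jet Φ m n) := fun m n =>
    (contDiff_jet hΦ m n).differentiable (by simp)
  simp only [lam, sectionalCurvature, metricInner, riemannCurv, Fin.sum_univ_two]
  simp [christoffel_hess_zero hΦ hKE, christoffel_hess_one hΦ hKE, pd_zero_jet, pd_one_jet hΦ]
  simp (disch := fun_prop) only [pd_mul, pd_sub, pd_const, pd_exp, pd_zero_eq_jet Φ,
    pd_one_eq_jet Φ, pd_zero_jet, pd_one_jet hΦ, Nat.reduceAdd]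
  simp [hess, pd_zero_eq_jet Φ, pd_one_eq_jet Φ, pd_zero_jet, pd_one_jet hΦ]
  have h0 := jet_det hΦ hKE x
  have h1 := jet_det_pd_zero hΦ hKE x
  have h2 := jet_det_pd_one hΦ hKE x
  have hE : Real.exp (Φ x) * Real.exp (-Φ x) = 1 := by rw [← Real.exp_add]; simp
  rw [← h0] at hE h1 h2
  have hf : jet Φ 1 0 x = -(Real.exp (Φ x) * (jet Φ 0 2 x * jet Φ 3 0 x
      - 2 * jet Φ 1 1 x * jet Φ 2 1 x + jet Φ 2 0 x * jet Φ 1 2 x)) := by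
    linear_combination Real.exp (Φ x) * h1 - jet Φ 1 0 x * hE
  have hg : jet Φ 0 1 x = -(Real.exp (Φ x) * (jet Φ 0 2 x * jet Φ 2 1 x
      - 2 * jet Φ 1 1 x * jet Φ 1 2 x + jet Φ 2 0 x * jet Φ 0 3 x)) := by
    linear_combination Real.exp (Φ x) * h2 - jet Φ 0 1 x * hE
  rw [hf, hg]
  have hne := right_ne_zero_of_mul_eq_one hE
  have hE' := eq_div_of_mul_eq hne hE
  rw [hE']
  simp only [tri]
  field_simp
  ring

/-- The equation for `λ`, cleared of its denominator. -/
theorem lam_equation (hΦ : ContDiff ℝ ∞ Φ)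
    (hKE : ∀ x, Real.exp (-Φ x) = (hess Φ x).det) (x : EuclideanSpace ℝ (Fin 2)) :
    2 * (8 * lam Φ x + gradInner Φ Φ Φ x) * weightedLaplacian Φ (lam Φ) x =
      (8 * lam Φ x + gradInner Φ Φ Φ x) * ((3 * lam Φ x - 1) * (lam Φ x + 1)) +
      gradInner Φ Φ Φ x * (3 * lam Φ x - 1) ^ 2 +
      16 * gradInner Φ (lam Φ) (lam Φ) x +
      2 * (4 * (1 - lam Φ x) + gradInner Φ Φ Φ x) * gradInner Φ Φ (lam Φ) x := by
  have hd : Differentiable ℝ Φ := hΦ.differentiable (by simp)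
  have hJ : ∀ m n, Differentiable ℝ (jet Φ m n) := fun m n =>
    (contDiff_jet hΦ m n).differentiable (by simp)
  have hlam := lam_eq hΦ hKE
  have hlamC : ContDiff ℝ ∞ (lam Φ) := by
    have := contDiff_jet hΦ
    rw [hlam]
    unfold tri
    fun_prop
  have h0 := jet_det hΦ hKE
  have h1 := jet_det_pd_zero hΦ hKE
  have h2 := jet_det_pd_one hΦ hKE
  have h11 : ∀ x, jet Φ 0 2 x * jet Φ 4 0 x - 2 * jet Φ 1 1 x * jet Φ 3 1 x
      + jet Φ 2 0 x * jet Φ 2 2 x + 2 * (jet Φ 3 0 x * jet Φ 1 2 x - jet Φ 2 1 x ^ 2)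
      = (jet Φ 1 0 x ^ 2 - jet Φ 2 0 x) * Real.exp (-Φ x) := by
    intro x
    have h := congrArg (fun F => pd 0 F x) (funext h1)
    simp (disch := fun_prop) only [pd_mul, pd_sub, pd_add, pd_const, pd_exp, pd_neg,
      pd_zero_eq_jet Φ, pd_zero_jet, Nat.reduceAdd] at h
    linear_combination h
  have h12 : ∀ x, jet Φ 0 2 x * jet Φ 3 1 x - 2 * jet Φ 1 1 x * jet Φ 2 2 x
      + jet Φ 2 0 x * jet Φ 1 3 x + (jet Φ 3 0 x * jet Φ 0 3 x - jet Φ 2 1 x * jet Φ 1 2 x)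
      = (jet Φ 1 0 x * jet Φ 0 1 x - jet Φ 1 1 x) * Real.exp (-Φ x) := by
    intro x
    have h := congrArg (fun F => pd 1 F x) (funext h1)
    simp (disch := fun_prop) only [pd_mul, pd_sub, pd_add, pd_const, pd_exp, pd_neg,
      pd_one_eq_jet Φ, pd_one_jet hΦ, Nat.reduceAdd] at h
    linear_combination h
  have h22 : ∀ x, jet Φ 0 2 x * jet Φ 2 2 x - 2 * jet Φ 1 1 x * jet Φ 1 3 x
      + jet Φ 2 0 x * jet Φ 0 4 x + 2 * (jet Φ 2 1 x * jet Φ 0 3 x - jet Φ 1 2 x ^ 2)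
      = (jet Φ 0 1 x ^ 2 - jet Φ 0 2 x) * Real.exp (-Φ x) := by
    intro x
    have h := congrArg (fun F => pd 1 F x) (funext h2)
    simp (disch := fun_prop) only [pd_mul, pd_sub, pd_add, pd_const, pd_exp, pd_neg,
      pd_one_eq_jet Φ, pd_one_jet hΦ, Nat.reduceAdd] at h
    linear_combination h
  have h111 := congrArg (fun F => pd 0 F x) (funext h11)
  have h112 := congrArg (fun F => pd 1 F x) (funext h11)
  have h122 := congrArg (fun F => pd 1 F x) (funext h12)
  have h222 := congrArg (fun F => pd 1 F x) (funext h22)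
  have hl := congrFun hlam
  simp (disch := fun_prop) only [pd_mul, pd_sub, pd_add, pd_const, pd_pow, pd_exp, pd_neg,
    pd_zero_eq_jet Φ, pd_zero_jet, pd_one_eq_jet Φ, pd_one_jet hΦ, Nat.reduceAdd]
    at h111 h112 h122 h222
  have hl1 : pd 0 (lam Φ) = fun x => Real.exp (Φ x) ^ 2 * (
      tri (jet Φ 2 0 x) (jet Φ 1 1 x) (jet Φ 0 2 x)
        (jet Φ 4 0 x) (jet Φ 3 1 x) (jet Φ 2 2 x) (jet Φ 2 1 x) (jet Φ 1 2 x) (jet Φ 0 3 x)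
      + tri (jet Φ 2 0 x) (jet Φ 1 1 x) (jet Φ 0 2 x)
        (jet Φ 3 0 x) (jet Φ 2 1 x) (jet Φ 1 2 x) (jet Φ 3 1 x) (jet Φ 2 2 x) (jet Φ 1 3 x)
      + 2 * jet Φ 1 0 x * tri (jet Φ 2 0 x) (jet Φ 1 1 x) (jet Φ 0 2 x)
        (jet Φ 3 0 x) (jet Φ 2 1 x) (jet Φ 1 2 x) (jet Φ 2 1 x) (jet Φ 1 2 x) (jet Φ 0 3 x)) := by
    funext x
    simp (disch := fun_prop) only [hlam, tri, pd_mul, pd_sub, pd_add, pd_pow, pd_exp,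
      pd_zero_eq_jet Φ, pd_zero_jet, Nat.reduceAdd, Nat.cast_ofNat]
    ring
  have hl2 : pd 1 (lam Φ) = fun x => Real.exp (Φ x) ^ 2 * (
      tri (jet Φ 2 0 x) (jet Φ 1 1 x) (jet Φ 0 2 x)
        (jet Φ 3 1 x) (jet Φ 2 2 x) (jet Φ 1 3 x) (jet Φ 2 1 x) (jet Φ 1 2 x) (jet Φ 0 3 x)
      + tri (jet Φ 2 0 x) (jet Φ 1 1 x) (jet Φ 0 2 x)
        (jet Φ 3 0 x) (jet Φ 2 1 x) (jet Φ 1 2 x) (jet Φ 2 2 x) (jet Φ 1 3 x) (jet Φ 0 4 x)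
      + 2 * jet Φ 0 1 x * tri (jet Φ 2 0 x) (jet Φ 1 1 x) (jet Φ 0 2 x)
        (jet Φ 3 0 x) (jet Φ 2 1 x) (jet Φ 1 2 x) (jet Φ 2 1 x) (jet Φ 1 2 x) (jet Φ 0 3 x)) := by
    funext x
    simp (disch := fun_prop) only [hlam, tri, pd_mul, pd_sub, pd_add, pd_pow, pd_exp,
      pd_one_eq_jet Φ, pd_one_jet hΦ, Nat.reduceAdd, Nat.cast_ofNat]
    ring
  have hE : Real.exp (Φ x) * Real.exp (-Φ x) = 1 := by rw [← Real.exp_add]; simp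
  have ha : jet Φ 2 0 x ≠ 0 := by
    intro ha
    have := h0 x
    rw [ha] at this
    nlinarith [Real.exp_pos (-Φ x), sq_nonneg (jet Φ 1 1 x)]
  have key := jet_identity (h0 x) hE (h1 x) (h2 x) (h11 x) (h12 x) (h22 x)
    (w0 := jet Φ 5 0 x) (w1 := jet Φ 4 1 x) (w2 := jet Φ 3 2 x) (w3 := jet Φ 2 3 x)
    (w4 := jet Φ 1 4 x) (w5 := jet Φ 0 5 x)
    (by linear_combination h111) (by linear_combination h112) (by linear_combination h122)
    (by linear_combination h222) (hl x) (congrFun hl1 x) (congrFun hl2 x)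
    (l11 := pd 0 (pd 0 (lam Φ)) x) (l12 := pd 1 (pd 0 (lam Φ)) x)
    (l22 := pd 1 (pd 1 (lam Φ)) x)
    (by
      rw [hl1]
      simp (disch := fun_prop) only [tri, pd_mul, pd_sub, pd_add, pd_const, pd_pow, pd_exp,
        pd_zero_eq_jet Φ, pd_zero_jet, Nat.reduceAdd, Nat.cast_ofNat]
      ring)
    (by
      rw [hl1]
      simp (disch := fun_prop) only [tri, pd_mul, pd_sub, pd_add, pd_const, pd_pow, pd_exp,
        pd_one_eq_jet Φ, pd_one_jet hΦ, Nat.reduceAdd, Nat.cast_ofNat]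
      ring)
    (by
      rw [hl2]
      simp (disch := fun_prop) only [tri, pd_mul, pd_sub, pd_add, pd_const, pd_pow, pd_exp,
        pd_one_eq_jet Φ, pd_one_jet hΦ, Nat.reduceAdd, Nat.cast_ofNat]
      ring) ha
  rw [weightedLaplacian_eq hΦ hKE hlamC]
  simp only [gradInner_eq hΦ hKE, pd_zero_eq_jet Φ, pd_one_eq_jet Φ]
  linear_combination key

end Plane

end HessianGeometry

theorem mainTheorem2 (Φ : EuclideanSpace ℝ (Fin 2) → ℝ)
    (hsmooth : ContDiff ℝ ∞ Φ)
    (hconvex : ConvexOn ℝ Set.univ Φ)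
    (hKE : ∀ x, Real.exp (-Φ x) = (HessianGeometry.hess Φ x).det) :
    (∀ x, 8 * HessianGeometry.lam Φ x + HessianGeometry.gradInner Φ Φ Φ x ≠ 0 →
      2 * HessianGeometry.weightedLaplacian Φ (HessianGeometry.lam Φ) x =
        (3 * HessianGeometry.lam Φ x - 1) * (HessianGeometry.lam Φ x + 1) +
        HessianGeometry.gradInner Φ Φ Φ x /
            (8 * HessianGeometry.lam Φ x + HessianGeometry.gradInner Φ Φ Φ x) *
          (3 * HessianGeometry.lam Φ x - 1) ^ 2 +
        (16 * HessianGeometry.gradInner Φ (HessianGeometry.lam Φ) (HessianGeometry.lam Φ) x +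
            2 * (4 * (1 - HessianGeometry.lam Φ x) + HessianGeometry.gradInner Φ Φ Φ x) *
              HessianGeometry.gradInner Φ Φ (HessianGeometry.lam Φ) x) /
          (8 * HessianGeometry.lam Φ x + HessianGeometry.gradInner Φ Φ Φ x)) ∧
    (∀ x,
      2 * (8 * HessianGeometry.lam Φ x + HessianGeometry.gradInner Φ Φ Φ x) *
          HessianGeometry.weightedLaplacian Φ (HessianGeometry.lam Φ) x =
        (8 * HessianGeometry.lam Φ x + HessianGeometry.gradInner Φ Φ Φ x) *
          ((3 * HessianGeometry.lam Φ x - 1) * (HessianGeometry.lam Φ x + 1)) +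
        HessianGeometry.gradInner Φ Φ Φ x * (3 * HessianGeometry.lam Φ x - 1) ^ 2 +
        16 * HessianGeometry.gradInner Φ (HessianGeometry.lam Φ) (HessianGeometry.lam Φ) x +
        2 * (4 * (1 - HessianGeometry.lam Φ x) + HessianGeometry.gradInner Φ Φ Φ x) *
          HessianGeometry.gradInner Φ Φ (HessianGeometry.lam Φ) x) := by
  refine ⟨fun x hx => ?_, HessianGeometry.lam_equation hsmooth hKE⟩
  have h := HessianGeometry.lam_equation hsmooth hKE x
  generalize 8 * HessianGeometry.lam Φ x + HessianGeometry.gradInner Φ Φ Φ x = D at hx h ⊢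
  field_simp
  linear_combination h
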